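/- Let $m$ and $e$ be positive integers with $m\ge 5$, $1\le e\le m-1$, $e\notin\{\frac m3,\frac{2m}3\}$ and $m/\gcd(m,e)$ odd. Put $q=2^m$ and let $\mathrm{Tr}$ denote the trace function from $\mathbb F_q$ to $\mathbb F_2$. Let $$\mathcal C=\left\{\left(\mathrm{Tr}\left(ax^{2^{2e}+1}+bx^{2^e+1}+cx\right)\right)_{x\in\mathbb F_q^*} : a,b,c\in\mathbb F_q\right\},$$ a binary linear code of length $q-1$. Let $\widehat{\mathcal C}$ be its augmented code, i.e. the code generated by $\mathcal C$ and the all-one word, and let $\overline{\widehat{\mathcal C}}$ be the extended code of $\widehat{\mathcal C}$, obtained by appending to every codeword $(c_x)_x$ of $\widehat{\mathcal C}$ the coordinate $-\sum_x c_x$. Then the dual code $\overline{\widehat{\mathcal C}}^{\perp}$ (with respect to the standard inner product) is a $[q,\,q-3m-1,\,d']$ binary linear code, that is, it has length $q$, dimension $q-3m-1$ and minimum Hamming distance $d'$, where $$d'=\begin{cases}8,&\text{if }\gcd(m,e)=1,\\ 4,&\text{otherwise.}\end{cases}$$ Moreover, if $\gcd(m,e)=1$, then the number of codewords of (minimum)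 weight $8$ in $\overline{\widehat{\mathcal C}}^{\perp}$ is $$A_8\left(\overline{\widehat{\mathcal C}}^{\perp}\right)=\frac1{315}\cdot 2^{m-7}\,(2^m-1)\left(-272+39\cdot 2^{2+m}-3\cdot 4^{m+1}+8^m\right).$$ -/

import Mathlib

section Codes

variable {K ι : Type*} [Field K]

/-- The augmented code: the code generated by `C` together with the all-one word. -/
def augmentedCode (C : Submodule K (ι → K)) : Submodule K (ι → K) :=
  C ⊔ Submodule.span K {fun _ => 1}

/-- A word extended by one further coordinate (with index `none`), which makes the sum of all
coordinates zero. -/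
def extendWord [Fintype ι] (c : ι → K) : Option ι → K
  | none => -∑ i, c i
  | some i => c i

/-- The extended code: the set of all extensions of words of `C`. -/
def extendedCode [Fintype ι] (C : Submodule K (ι → K)) : Submodule K (Option ι → K) where
  carrier := {w | ∃ c ∈ C, w = extendWord c}
  zero_mem' := ⟨0, C.zero_mem, by funext o; cases o <;> simp [extendWord]⟩
  add_mem' := by
    rintro _ _ ⟨c, hc, rfl⟩ ⟨c', hc', rfl⟩
    refine ⟨c + c', C.add_mem hc hc', ?_⟩
    funext o
    cases o
    · simp only [Pi.add_apply, extendWord, Finset.sum_add_distrib, neg_add]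
    · simp [extendWord]
  smul_mem' := by
    rintro r _ ⟨c, hc, rfl⟩
    refine ⟨r • c, C.smul_mem r hc, ?_⟩
    funext o
    cases o
    · simp only [Pi.smul_apply, extendWord, smul_eq_mul, ← Finset.mul_sum, mul_neg]
    · simp [extendWord]

/-- The dual code with respect to the standard dot product. -/
def dualCode [Fintype ι] (C : Submodule K (ι → K)) : Submodule K (ι → K) where
  carrier := {v | ∀ c ∈ C, v ⬝ᵥ c = 0}
  zero_mem' := fun c _ => zero_dotProduct c
  add_mem' := by
    intro v w hv hw c hc
    rw [add_dotProduct, hv c hc, hw c hc, add_zero]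
  smul_mem' := by
    intro r v hv c hc
    rw [smul_dotProduct, hv c hc, smul_zero]

/-- `C` is an `[n, k, d]` linear code: it has length `n`, dimension `k`, and minimum Hamming
distance `d` (attained by a pair of distinct codewords). -/
def IsLinearCode [Fintype ι] [DecidableEq K] (C : Submodule K (ι → K)) (n k d : ℕ) : Prop :=
  Fintype.card ι = n ∧ Module.finrank K C = k ∧
    IsLeast {t : ℕ | ∃ x ∈ C, ∃ y ∈ C, x ≠ y ∧ hammingDist x y = t} d

/-- The number of codewords of Hamming weight `i` in `C`. -/
noncomputable def weightCount [Fintype ι] [DecidableEq K] (C : Submodule K (ι → K)) (i : ℕ) : ℕ :=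
  {c : ι → K | c ∈ C ∧ hammingNorm c = i}.ncard

end Codes

/-- The binary code, with coordinates indexed by the nonzero elements `x` of the field `F`, of all
words `(Tr(a x^(2^(2e)+1) + b x^(2^e+1) + c x))_x` with `a, b, c ∈ F`. -/
noncomputable def threeZeroCode (F : Type*) [Field F] [Algebra (ZMod 2) F] (e : ℕ) :
    Submodule (ZMod 2) (Fˣ → ZMod 2) where
  carrier := {w | ∃ a b c : F, w = fun x : Fˣ =>
    Algebra.trace (ZMod 2) F
      (a * (x : F) ^ (2 ^ (2 * e) + 1) + b * (x : F) ^ (2 ^ e + 1) + c * (x : F))}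
  zero_mem' := ⟨0, 0, 0, by funext x; simp⟩
  add_mem' := by
    rintro _ _ ⟨a, b, c, rfl⟩ ⟨a', b', c', rfl⟩
    refine ⟨a + a', b + b', c + c', ?_⟩
    funext x
    rw [Pi.add_apply, ← map_add]
    congr 1
    ring
  smul_mem' := by
    rintro r _ ⟨a, b, c, rfl⟩
    refine ⟨r • a, r • b, r • c, ?_⟩
    funext x
    rw [Pi.smul_apply, ← map_smul]
    congr 1
    simp only [smul_add, smul_mul_assoc]

/-! Write `σ` for the map x ↦ x^(2^e), d = gcd(m, e), q = 2^m. The extended augmented code `D`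
consists of the evaluations on all of F of Q(x) + h, with Q(x) = Tr(a σ²(x)x + b σ(x)x + cx). The
polarization of Q is given by a linearized polynomial of σ-degree at most 4, so for (a, b) ≠ 0 its
kernel has at most 2^(4d) elements (`card_roots_linearized_le`). The hypotheses force 5d ≤ m, so the
coefficients are determined by the word and `D` has dimension 3m + 1.

If d = 1, then m is odd, and squaring the exponential sum P of Q + h gives P² ∈ {0, 2q, 8q} for
every nonconstant word. The dual has no words of odd weight (the all-one word is in `D`), of weight
2, or of weight 4 (the Gold function is almost perfect nonlinear). Summing P²(P² - 2q)(P² - 8q) and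
P⁴(P² - 2q)(P² - 8q) over `D` leaves only the two constant words; expressing the power moments by
dual weights (`sum_pow_sum_binarySign`) turns this into A₆ = 0 and the value of A₈, which is
positive.

If d > 1, then `σ` fixes some z outside the prime field, and {0, 1, z, z + 1} supports a dual word
of weight 4; weights 1, 2 and 3 remain excluded. -/

/-! ### Power moments of a binary code and the weights of its dual. -/

section PowerMoments

/-- The sign `(-1)^t` of a binary digit `t`. -/
def binarySign (t : ZMod 2) : ℤ := if t = 0 then 1 else -1

@[simp] lemma binarySign_zero : binarySign 0 = 1 := rfl

lemma binarySign_add (s t : ZMod 2) : binarySign (s + t) = binarySign s * binarySign t := by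
  revert s t; decide

lemma binarySign_of_ne_zero {t : ZMod 2} (ht : t ≠ 0) : binarySign t = -1 := if_neg ht

lemma sum_binarySign_eq_card {G : Type*} [Fintype G] {φ : G → ZMod 2} (h : ∀ g, φ g = 0) :
    ∑ g, binarySign (φ g) = Fintype.card G := by
  simp [h]

lemma sum_binarySign_eq_zero {G : Type*} [AddGroup G] [Fintype G] {φ : G → ZMod 2}
    (hφ : ∀ x y, φ (x + y) = φ x + φ y) (h : ∃ g, φ g ≠ 0) :
    ∑ g, binarySign (φ g) = 0 := by
  obtain ⟨g, hg⟩ := h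
  have h1 : ∑ x, binarySign (φ (x + g)) = ∑ x, binarySign (φ x) :=
    Equiv.sum_comp (Equiv.addRight g) (fun x => binarySign (φ x))
  simp only [hφ, binarySign_add, binarySign_of_ne_zero hg, ← Finset.sum_mul] at h1
  linarith

/-- The number of `k`-tuples of coordinates, out of `n`, in which the coordinates occurring an odd
number of times are exactly those of a given set of size `w`. -/
def oddTupleCount (n : ℤ) : ℕ → ℕ → ℤ
  | 0, w => if w = 0 then 1 else 0
  -- At `w = 0` the truncated `w - 1` is harmless, since its coefficient is zero.
  | k + 1, w => w * oddTupleCount n k (w - 1) + (n - w) * oddTupleCount n k (w + 1)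

lemma oddTupleCount_eq_zero (n : ℤ) {k w : ℕ} (h : k < w) : oddTupleCount n k w = 0 := by
  induction k generalizing w with
  | zero => simp [oddTupleCount]; omega
  | succ k ih => simp [oddTupleCount, ih (w := w - 1) (by omega), ih (w := w + 1) (by omega)]

variable {ι : Type*} [Fintype ι]

lemma natCast_hammingNorm (w : ι → ZMod 2) : (hammingNorm w : ZMod 2) = ∑ i, w i := by
  rw [hammingNorm, Finset.card_filter, Nat.cast_sum]
  refine Finset.sum_congr rfl fun i _ => ?_
  generalize w i = t
  revert t; decide

lemma sum_oddTupleCount_hammingNorm (s : Finset (ι → ZMod 2)) {k N : ℕ} (hk : k < N) :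
    ∑ v ∈ s, oddTupleCount (Fintype.card ι) k (hammingNorm v) =
      ∑ w ∈ Finset.range N, ({v ∈ s | hammingNorm v = w}.card : ℤ) *
        oddTupleCount (Fintype.card ι) k w := by
  have h : ∀ v ∈ s, oddTupleCount (Fintype.card ι) k (hammingNorm v) =
      ∑ w ∈ Finset.range N, if hammingNorm v = w then oddTupleCount (Fintype.card ι) k w else 0 := by
    intro v _
    rw [Finset.sum_ite_eq]
    split_ifs with h
    · rfl
    · exact oddTupleCount_eq_zero _ (by simp at h; omega)
  rw [Finset.sum_congr rfl h, Finset.sum_comm]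
  refine Finset.sum_congr rfl fun w _ => ?_
  rw [← Finset.sum_filter, Finset.sum_const, nsmul_eq_mul]

variable [DecidableEq ι]

lemma hammingNorm_add_single_of_eq_zero {w : ι → ZMod 2} {i : ι} (h : w i = 0) :
    hammingNorm (w + Pi.single i 1) = hammingNorm w + 1 := by
  rw [hammingNorm, hammingNorm,
    ← Finset.card_insert_of_notMem (a := i) (s := Finset.univ.filter fun j => w j ≠ 0) (by simp [h])]
  congr 1
  ext j
  by_cases hj : j = i
  · subst hj; simp [h]
  · simp [hj]

lemma hammingNorm_add_single_of_ne_zero {w : ι → ZMod 2} {i : ι} (h : w i ≠ 0) :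
    hammingNorm (w + Pi.single i 1) = hammingNorm w - 1 := by
  have h1 : w i = 1 := by
    generalize w i = t at h; revert t; decide
  have h2 : (w + Pi.single i 1 : ι → ZMod 2) i = 0 := by simp [h1]; decide
  have h3 := hammingNorm_add_single_of_eq_zero h2
  rw [add_assoc, ← Pi.single_add, show (1 : ZMod 2) + 1 = 0 from rfl, Pi.single_zero,
    add_zero] at h3
  omega

/-- Flipping a coordinate in the support lowers the weight by one, flipping any other raises it by
one; this is the recursion defining `oddTupleCount`. -/
lemma sum_oddTupleCount_add_single (k : ℕ) (w : ι → ZMod 2) :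
    ∑ i, oddTupleCount (Fintype.card ι) k (hammingNorm (w + Pi.single i 1)) =
      oddTupleCount (Fintype.card ι) (k + 1) (hammingNorm w) := by
  have h1 : (Finset.univ.filter fun i => w i ≠ 0).card = hammingNorm w := rfl
  have h2 := Finset.card_filter_add_card_filter_not (s := (Finset.univ : Finset ι))
    (fun i => w i ≠ 0)
  rw [h1, Finset.card_univ] at h2
  rw [← Finset.sum_filter_add_sum_filter_not _ (fun i => w i ≠ 0), oddTupleCount]
  congr 1
  · rw [Finset.sum_congr rfl fun i hi => by
      rw [hammingNorm_add_single_of_ne_zero (Finset.mem_filter.1 hi).2]]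
    rw [Finset.sum_const, h1, nsmul_eq_mul]
  · rw [Finset.sum_congr rfl fun i hi => by
      rw [hammingNorm_add_single_of_eq_zero (not_not.1 (Finset.mem_filter.1 hi).2)]]
    rw [Finset.sum_const, nsmul_eq_mul, ← h2]
    push_cast
    ring

/-- In the expanded power, a tuple of coordinates contributes a sign that depends only on its parity
vector `v`, and the number of tuples with that vector depends only on the weight of `v`. -/
lemma sum_binarySign_pow (c : ι → ZMod 2) (k : ℕ) :
    (∑ i, binarySign (c i)) ^ k =
      ∑ v : ι → ZMod 2,
        oddTupleCount (Fintype.card ι) k (hammingNorm v) * binarySign (v ⬝ᵥ c) := by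
  induction k with
  | zero =>
    rw [Finset.sum_eq_single (0 : ι → ZMod 2)]
    · simp [oddTupleCount]
    · intro v _ hv
      simp [oddTupleCount, hv]
    · simp
  | succ k ih =>
    simp only [← sum_oddTupleCount_add_single, Finset.sum_mul]
    rw [pow_succ, ih, Finset.mul_sum, Finset.sum_comm]
    refine Finset.sum_congr rfl fun i _ => ?_
    rw [← Equiv.sum_comp (Equiv.addRight (Pi.single i (1 : ZMod 2))), Finset.sum_mul]
    refine Finset.sum_congr rfl fun v _ => ?_
    have h : v + Pi.single i (1 : ZMod 2) + Pi.single i 1 = v := by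
      rw [add_assoc, ← Pi.single_add, show (1 : ZMod 2) + 1 = 0 from rfl, Pi.single_zero, add_zero]
    have h' : binarySign (c i) * binarySign (c i) = 1 := by
      generalize c i = t
      revert t; decide
    simp only [Equiv.coe_addRight, add_dotProduct, single_dotProduct, one_mul, binarySign_add]
    rw [mul_assoc, mul_assoc, h', mul_one]

/-- The power moments of a binary linear code, in terms of the weights of its dual. -/
theorem sum_pow_sum_binarySign (D : Submodule (ZMod 2) (ι → ZMod 2)) [DecidablePred (· ∈ D)]
    [DecidablePred (· ∈ dualCode D)] (k : ℕ) :
    ∑ c : D, (∑ i, binarySign (c.1 i)) ^ k =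
      Fintype.card D * ∑ v with v ∈ dualCode D,
        oddTupleCount (Fintype.card ι) k (hammingNorm v) := by
  simp only [sum_binarySign_pow]
  rw [Finset.sum_comm, Finset.mul_sum, Finset.sum_filter]
  refine Finset.sum_congr rfl fun v _ => ?_
  rw [← Finset.mul_sum]
  -- Orthogonality: `c ↦ v ⬝ᵥ c` is additive on `D`, hence its signs cancel unless `v` is in the
  -- dual.
  split_ifs with hv
  · rw [sum_binarySign_eq_card (fun c : D => hv c c.2), mul_comm]
  · rw [sum_binarySign_eq_zero, mul_zero]
    · intro x y
      simp [dotProduct_add]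
    · by_contra! h
      exact hv fun c hc => h ⟨c, hc⟩

end PowerMoments

/-! ### Dimension of the dual code. -/

section DualDimension

variable {K ι : Type*} [Field K] [Fintype ι]

lemma finrank_dualCode (D : Submodule K (ι → K)) :
    Module.finrank K (dualCode D) = Fintype.card ι - Module.finrank K D := by
  classical
  let B : LinearMap.BilinForm K (ι → K) := dotProductBilin K K
  have hn : B.Nondegenerate := by
    refine ⟨fun x h => dotProduct_eq_zero x h, fun y h => dotProduct_eq_zero y fun x => ?_⟩
    rw [dotProduct_comm]
    exact h x
  have h := LinearMap.BilinForm.finrank_orthogonal hn D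
  rw [Module.finrank_fintype_fun_eq_card] at h
  rw [← h]
  have hD : dualCode D = B.orthogonal D := by
    ext v
    simp only [LinearMap.BilinForm.mem_orthogonal_iff]
    refine forall₂_congr fun c _ => ?_
    simp [B, dotProduct_comm]
  rw [hD]

end DualDimension

/-! ### Root counts for linearized polynomials. -/

section LinearizedPolynomials

/-- Summation by parts. With `s i` the iterates of `σ` at one point, the differences are the
iterates at `σ u - u`, and the order drops by one once the `b i` sum to zero. -/
lemma sum_range_mul_eq_neg_sum_range {R : Type*} [CommRing R] (b s : ℕ → R) (n : ℕ) :
    ∑ i ∈ Finset.range (n + 1), b i * s i =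
      (∑ i ∈ Finset.range (n + 1), b i) * s n +
        ∑ i ∈ Finset.range n, (-∑ j ∈ Finset.range (i + 1), b j) * (s (i + 1) - s i) := by
  induction n with
  | zero => simp
  | succ n ih =>
    rw [Finset.sum_range_succ, ih, Finset.sum_range_succ b (n + 1), Finset.sum_range_succ
      (fun i => (-∑ j ∈ Finset.range (i + 1), b j) * (s (i + 1) - s i)) n]
    ring

variable {F : Type*} [Field F] [Fintype F] [DecidableEq F]

/-- A nonzero linearized polynomial of degree at most `n` in an endomorphism `σ` of a finite field
has at most `r ^ n` roots, where `r` is the size of the fixed field of `σ`. -/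
theorem card_roots_linearized_le (σ : F →+* F) (n : ℕ) (a : ℕ → F)
    (ha : ∃ i ≤ n, a i ≠ 0) :
    (Finset.univ.filter fun y => ∑ i ∈ Finset.range (n + 1), a i * σ^[i] y = 0).card ≤
      (Finset.univ.filter fun y => σ y = y).card ^ n := by
  set r := (Finset.univ.filter fun y => σ y = y).card with hr
  have hr0 : 0 < r := Finset.card_pos.2 ⟨0, by simp⟩
  induction n generalizing a with
  | zero =>
    obtain ⟨i, hi, hi'⟩ := ha
    obtain rfl : i = 0 := by omega
    simp [hi', Finset.filter_eq']
  | succ n ih =>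
    by_cases hy : ∃ y ≠ 0, ∑ i ∈ Finset.range (n + 1 + 1), a i * σ^[i] y = 0
    swap
    · push Not at hy
      refine le_trans (Finset.card_le_card (t := {0}) fun y hy' => ?_)
        (by simpa using Nat.one_le_pow _ _ hr0)
      by_contra h
      exact hy y (by simpa using h) (Finset.mem_filter.1 hy').2
    obtain ⟨y, hy0, hy⟩ := hy
    have hs : ∀ i (u v : F), σ^[i] (u * v) = σ^[i] u * σ^[i] v := fun i u v => by
      rw [← RingHom.coe_pow, map_mul]
    have hs' : ∀ i (u v : F), σ^[i] (u - v) = σ^[i] u - σ^[i] v := fun i u v => by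
      rw [← RingHom.coe_pow, map_sub]
    have hs0 : ∀ i, σ^[i] y ≠ 0 := fun i => by
      rw [← RingHom.coe_pow]; exact (map_ne_zero _).2 hy0
    let b : ℕ → F := fun i => a i * σ^[i] y
    let c : ℕ → F := fun i => -∑ j ∈ Finset.range (i + 1), b j
    -- If every partial sum of `b` vanished (the full one does, `y` being a root), every `b i` would
    -- vanish, and so every `a i`.
    have hc : ∃ i ≤ n, c i ≠ 0 := by
      by_contra! h
      have hB : ∀ i ≤ n + 1, ∑ j ∈ Finset.range (i + 1), b j = 0 := by
        intro i hi
        rcases Nat.lt_or_ge n i with h1 | h1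
        · obtain rfl : i = n + 1 := by omega
          exact hy
        · exact neg_eq_zero.1 (h i h1)
      obtain ⟨i, hi, hi'⟩ := ha
      have hb : b i = 0 := by
        have h2 := hB i hi
        rw [Finset.sum_range_succ] at h2
        rcases i with _ | i
        · simpa using h2
        · rwa [hB i (by omega), zero_add] at h2
      exact mul_ne_zero hi' (hs0 i) hb
    -- The map z ↦ σ(z/y) - z/y sends roots to roots of the equation of order `n` with coefficients
    -- `c`; two roots in one fibre differ by `y` times a fixed point of `σ`, so fibres have at most
    -- `r` elements.
    rw [pow_succ']
    refine le_trans (Finset.card_le_mul_card_image_of_maps_to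
      (t := Finset.univ.filter fun z => ∑ i ∈ Finset.range (n + 1), c i * σ^[i] z = 0)
      (f := fun z => σ (z / y) - z / y) ?_ r ?_) (Nat.mul_le_mul_left _ (ih c hc))
    · intro z hz
      simp only [Finset.mem_filter, Finset.mem_univ, true_and] at hz ⊢
      have h := sum_range_mul_eq_neg_sum_range b (fun i => σ^[i] (z / y)) (n + 1)
      have h1 : ∑ i ∈ Finset.range (n + 1 + 1), b i * σ^[i] (z / y) = 0 := by
        rw [← hz]
        refine Finset.sum_congr rfl fun i _ => ?_
        rw [mul_assoc, ← hs, mul_div_cancel₀ _ hy0]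
      rw [h1, show ∑ i ∈ Finset.range (n + 1 + 1), b i = 0 from hy, zero_mul, zero_add] at h
      rw [h]
      refine Finset.sum_congr rfl fun i _ => ?_
      rw [hs', ← Function.iterate_succ_apply]
    · intro t _
      rcases Finset.eq_empty_or_nonempty
        {z ∈ Finset.univ.filter fun y => ∑ i ∈ Finset.range (n + 1 + 1), a i * σ^[i] y = 0 |
          σ (z / y) - z / y = t} with h | ⟨w, hw⟩
      · rw [h]; simp
      · rw [hr]
        have hw' := (Finset.mem_filter.1 hw).2
        refine Finset.card_le_card_of_injOn (fun z => z / y - w / y) ?_ ?_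
        · intro z hz
          have hz' := (Finset.mem_filter.1 hz).2
          simp only [Finset.coe_filter, Finset.mem_univ, true_and, Set.mem_ofPred_eq, map_sub]
          linear_combination hz' - hw'
        · intro z _ z' _ h
          have h' : z / y = z' / y := by simpa using h
          field_simp at h'
          exact h'

/-- The number of fixed points of the `e`-th power of the Frobenius of a field of `2 ^ m`
elements. -/
lemma card_fixed_two_pow_le {m e : ℕ} (hm : 0 < m) (hF : Fintype.card F = 2 ^ m) :
    (Finset.univ.filter fun y : F => y ^ 2 ^ e = y).card ≤ 2 ^ Nat.gcd m e := by
  have hd : 0 < Nat.gcd m e := Nat.gcd_pos_of_pos_left _ hm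
  have h2 : 1 < 2 ^ Nat.gcd m e := Nat.one_lt_two_pow hd.ne'
  have hit : ∀ (k : ℕ) (y : F), (fun x : F => x ^ 2)^[k] y = y ^ 2 ^ k := fun k y => by
    rw [pow_iterate]
  have hne := FiniteField.X_pow_card_sub_X_ne_zero F h2
  refine le_trans (Finset.card_le_card (t := (Polynomial.X ^ 2 ^ Nat.gcd m e - Polynomial.X :
    Polynomial F).roots.toFinset) fun y hy => ?_) ?_
  -- A fixed point has periods `e` and `m` under squaring, hence period gcd(m, e).
  · have h1 : Function.IsPeriodicPt (fun x : F => x ^ 2) e y := by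
      rw [Function.IsPeriodicPt, Function.IsFixedPt, hit]; exact (Finset.mem_filter.1 hy).2
    have h3 : Function.IsPeriodicPt (fun x : F => x ^ 2) m y := by
      rw [Function.IsPeriodicPt, Function.IsFixedPt, hit, ← hF, FiniteField.pow_card]
    have h4 := h3.gcd h1
    rw [Function.IsPeriodicPt, Function.IsFixedPt, hit] at h4
    rw [Multiset.mem_toFinset, Polynomial.mem_roots hne]
    simp [h4]
  · refine (Multiset.toFinset_card_le _).trans ((Polynomial.card_roots' _).trans ?_)
    rw [FiniteField.X_pow_card_sub_X_natDegree_eq F h2]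

end LinearizedPolynomials

/-! ### Exponential sums of quadratic trace functions. -/

section QuadraticTrace

variable {F : Type*} [Field F] [Algebra (ZMod 2) F]

lemma charP_two_of_algebra_zmod (F : Type*) [Field F] [Algebra (ZMod 2) F] : CharP F 2 :=
  charP_of_injective_algebraMap (algebraMap (ZMod 2) F).injective 2

/-- The function `Tr(a σ²(x) x + b σ(x) x + c x)`. -/
noncomputable def quadraticTrace (σ : F ≃ₐ[ZMod 2] F) (a b c x : F) : ZMod 2 :=
  Algebra.trace (ZMod 2) F (a * (σ (σ x) * x) + b * (σ x * x) + c * x)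

/-- The coefficients of the linearized polynomial that represents the polarization of
`quadraticTrace σ a b c`. -/
def polarCoeff (σ : F ≃ₐ[ZMod 2] F) (a b : F) : ℕ → F
  | 0 => a
  | 1 => σ b
  | 3 => σ (σ b)
  | 4 => σ (σ a)
  | _ => 0

/-- The linearized polynomial that represents the polarization of `quadraticTrace σ a b c`. -/
def polarMap (σ : F ≃ₐ[ZMod 2] F) (a b : F) : F →ₗ[ZMod 2] F where
  toFun y := a * y + σ b * σ y + σ (σ b) * σ (σ (σ y)) + σ (σ a) * σ (σ (σ (σ y)))
  map_add' x y := by simp only [map_add]; ring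
  map_smul' r x := by simp only [map_smul, RingHom.id_apply, mul_smul_comm, smul_add]

lemma polarMap_eq_sum (σ : F ≃ₐ[ZMod 2] F) (a b y : F) :
    polarMap σ a b y =
      ∑ i ∈ Finset.range (4 + 1), polarCoeff σ a b i * (σ : F →+* F)^[i] y := by
  simp [Finset.sum_range_succ, polarCoeff, polarMap]

lemma polarCoeff_ne_zero {σ : F ≃ₐ[ZMod 2] F} {a b : F} (h : ¬(a = 0 ∧ b = 0)) :
    ∃ i ≤ 4, polarCoeff σ a b i ≠ 0 := by
  by_cases ha : a = 0
  · exact ⟨1, by simp, by simpa [polarCoeff] using fun hb => h ⟨ha, hb⟩⟩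
  · exact ⟨0, by simp, ha⟩

lemma quadraticTrace_zero (σ : F ≃ₐ[ZMod 2] F) (a b c : F) : quadraticTrace σ a b c 0 = 0 := by
  simp [quadraticTrace]

/-- The trace is invariant under `σ`, so `σ` can be applied to each cross term until `x` occurs as
σ²(x). This clears negative powers of `σ` from the other factor. -/
lemma quadraticTrace_add (σ : F ≃ₐ[ZMod 2] F) (a b c x y : F) :
    quadraticTrace σ a b c (x + y) = quadraticTrace σ a b c x + quadraticTrace σ a b c y +
      Algebra.trace (ZMod 2) F (σ (σ x) * polarMap σ a b y) := by
  have ht : ∀ z, Algebra.trace (ZMod 2) F (σ z) = Algebra.trace (ZMod 2) F z :=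
    Algebra.trace_eq_of_algEquiv σ
  have h1 : Algebra.trace (ZMod 2) F (σ (σ x) * (σ b * σ y)) =
      Algebra.trace (ZMod 2) F (b * (σ x * y)) := by
    rw [← ht (b * (σ x * y))]; congr 1; simp only [map_mul]; ring
  have h2 : Algebra.trace (ZMod 2) F (σ (σ x) * (σ (σ b) * σ (σ (σ y)))) =
      Algebra.trace (ZMod 2) F (b * (σ y * x)) := by
    rw [← ht (b * (σ y * x)), ← ht (σ _)]; congr 1; simp only [map_mul]; ring
  have h3 : Algebra.trace (ZMod 2) F (σ (σ x) * (σ (σ a) * σ (σ (σ (σ y))))) =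
      Algebra.trace (ZMod 2) F (a * (σ (σ y) * x)) := by
    rw [← ht (a * (σ (σ y) * x)), ← ht (σ _)]; congr 1; simp only [map_mul]; ring
  have h4 : σ (σ x) * polarMap σ a b y = σ (σ x) * (a * y) + σ (σ x) * (σ b * σ y) +
      σ (σ x) * (σ (σ b) * σ (σ (σ y))) + σ (σ x) * (σ (σ a) * σ (σ (σ (σ y)))) := by
    simp only [polarMap, LinearMap.coe_mk, AddHom.coe_mk]; ring
  rw [h4, map_add, map_add, map_add, h1, h2, h3]
  simp only [quadraticTrace, ← LinearMap.map_add (Algebra.trace (ZMod 2) F)]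
  congr 1
  simp only [map_add]
  ring

variable [Fintype F]

lemma exists_trace_mul_ne_zero {z : F} (hz : z ≠ 0) :
    ∃ x, Algebra.trace (ZMod 2) F (x * z) ≠ 0 := by
  by_contra! h
  refine hz ((traceForm_nondegenerate (ZMod 2) F).1 z fun x => ?_)
  rw [Algebra.traceForm_apply, mul_comm]
  exact h x

/-- The square of the exponential sum of a quadratic trace function. -/
lemma sq_sum_binarySign_quadraticTrace (σ : F ≃ₐ[ZMod 2] F) (a b c : F) (h : ZMod 2)
    [Fintype (LinearMap.ker (polarMap σ a b))] :
    (∑ x, binarySign (quadraticTrace σ a b c x + h)) ^ 2 =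
      Fintype.card F *
        ∑ y : LinearMap.ker (polarMap σ a b), binarySign (quadraticTrace σ a b c y) := by
  classical
  have hchar := charP_two_of_algebra_zmod F
  have h1 : ∀ y x, binarySign (quadraticTrace σ a b c x + h) *
      binarySign (quadraticTrace σ a b c (x + y) + h) =
      binarySign (quadraticTrace σ a b c y) *
        binarySign (Algebra.trace (ZMod 2) F (σ (σ x) * polarMap σ a b y)) := by
    intro y x
    rw [← binarySign_add, ← binarySign_add, quadraticTrace_add]
    congr 1
    linear_combination (CharTwo.add_self_eq_zero (quadraticTrace σ a b c x)) +
      CharTwo.add_self_eq_zero h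
  -- For fixed `y` this is a sum of an additive character in `x`, nontrivial exactly when `y` is
  -- outside the kernel.
  have h2 : ∀ y, ∑ x, binarySign (Algebra.trace (ZMod 2) F (σ (σ x) * polarMap σ a b y)) =
      if y ∈ LinearMap.ker (polarMap σ a b) then (Fintype.card F : ℤ) else 0 := by
    intro y
    split_ifs with hy
    · rw [LinearMap.mem_ker] at hy
      exact sum_binarySign_eq_card fun x => by rw [hy, mul_zero, map_zero]
    · obtain ⟨x, hx⟩ := exists_trace_mul_ne_zero hy
      refine sum_binarySign_eq_zero (fun u v => ?_) ⟨σ.symm (σ.symm x), by simpa using hx⟩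
      rw [map_add, map_add, add_mul, map_add]
  calc (∑ x, binarySign (quadraticTrace σ a b c x + h)) ^ 2
      = ∑ x, ∑ y, binarySign (quadraticTrace σ a b c x + h) *
          binarySign (quadraticTrace σ a b c (x + y) + h) := by
        rw [sq, Finset.sum_mul_sum]
        refine Finset.sum_congr rfl fun x _ => ?_
        exact (Equiv.sum_comp (Equiv.addLeft x) fun y =>
          binarySign (quadraticTrace σ a b c x + h) * binarySign (quadraticTrace σ a b c y + h)).symm
    _ = ∑ y, if y ∈ LinearMap.ker (polarMap σ a b) then
          binarySign (quadraticTrace σ a b c y) * Fintype.card F else 0 := by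
        rw [Finset.sum_comm]
        refine Finset.sum_congr rfl fun y _ => ?_
        simp only [h1]
        rw [← Finset.mul_sum, h2, mul_ite, mul_zero]
    _ = _ := by
        rw [← Finset.sum_filter, Finset.mul_sum]
        rw [Finset.sum_subtype (p := fun y => y ∈ LinearMap.ker (polarMap σ a b)) _ (by simp)]
        exact Finset.sum_congr (by congr!) fun y _ => mul_comm _ _

lemma natCard_ker_polarMap_le [DecidableEq F] (σ : F ≃ₐ[ZMod 2] F) {a b : F}
    (h : ¬(a = 0 ∧ b = 0)) :
    Nat.card (LinearMap.ker (polarMap σ a b)) ≤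
      (Finset.univ.filter fun y => σ y = y).card ^ 4 := by
  refine le_trans (le_of_eq ?_)
    (card_roots_linearized_le (σ : F →+* F) 4 _ (polarCoeff_ne_zero (σ := σ) h))
  refine Nat.subtype_card _ fun x => ?_
  simp only [Finset.mem_filter, Finset.mem_univ, true_and, LinearMap.mem_ker, polarMap_eq_sum]

/-- If the fixed field of `σ` is the prime field, then the exponential sums of the quadratic trace
functions have the values `0`, `±√(2q)` and `±√(8q)` only. -/
theorem sq_sum_binarySign_quadraticTrace_mem [DecidableEq F] (σ : F ≃ₐ[ZMod 2] F) {m : ℕ}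
    (hF : Fintype.card F = 2 ^ m) (hm : Odd m)
    (hσ : (Finset.univ.filter fun y => σ y = y).card ≤ 2) {a b : F} (hab : ¬(a = 0 ∧ b = 0))
    (c : F) (h : ZMod 2) {P : ℤ} (hP : P = ∑ x, binarySign (quadraticTrace σ a b c x + h)) :
    P ^ 2 = 0 ∨ P ^ 2 = 2 * 2 ^ m ∨ P ^ 2 = 8 * 2 ^ m := by
  classical
  have hchar := charP_two_of_algebra_zmod F
  have hsq := sq_sum_binarySign_quadraticTrace σ a b c h
  rw [← hP, hF] at hsq
  -- On the kernel the quadratic function is additive, so its sign sum is 0 or the size 2^k of the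
  -- kernel.
  by_cases hz : ∃ y : LinearMap.ker (polarMap σ a b), quadraticTrace σ a b c y ≠ 0
  · left
    rw [hsq, sum_binarySign_eq_zero _ hz, mul_zero]
    intro x y
    rw [Submodule.coe_add, quadraticTrace_add, LinearMap.mem_ker.1 y.2, mul_zero, map_zero,
      add_zero]
  right
  push Not at hz
  rw [sum_binarySign_eq_card hz] at hsq
  have hk := Module.card_eq_pow_finrank (K := ZMod 2) (V := LinearMap.ker (polarMap σ a b))
  have hle := (natCard_ker_polarMap_le σ hab).trans (Nat.pow_le_pow_left hσ 4)
  rw [ZMod.card] at hk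
  rw [Nat.card_eq_fintype_card, hk] at hle
  generalize Module.finrank (ZMod 2) (LinearMap.ker (polarMap σ a b)) = k at hk hle
  have hk4 : k ≤ 4 := (Nat.pow_le_pow_iff_right (by norm_num)).1 hle
  rw [hk] at hsq
  -- A power of two that is a square has even exponent; with `m` odd and k ≤ 4, `k` is 1 or 3.
  have hn : P.natAbs ^ 2 = 2 ^ (m + k) := by
    zify
    rw [sq_abs, hsq, pow_add]
    push_cast
    rfl
  obtain ⟨j, -, hj⟩ := (Nat.dvd_prime_pow Nat.prime_two).1
    ((dvd_pow_self P.natAbs two_ne_zero).trans hn.dvd)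
  rw [hj, ← pow_mul] at hn
  have hjk := Nat.pow_right_injective le_rfl hn
  obtain ⟨t, ht⟩ := hm
  have : k = 1 ∨ k = 3 := by omega
  rcases this with rfl | rfl
  · left; rw [hsq]; push_cast; ring
  · right; rw [hsq]; push_cast; ring

end QuadraticTrace

/-! ### The extended augmented code as evaluations on the whole field. -/

section ThreeZeroCode

variable {F : Type*} [Field F]

/-- The element of the field at an index of the extended code. -/
def unitsOptionVal (o : Option Fˣ) : F := o.elim 0 fun u => u

lemma unitsOptionVal_bijective : Function.Bijective (unitsOptionVal (F := F)) := by
  classical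
  constructor
  · rintro (_ | u) (_ | v) h
    · rfl
    · exact absurd h.symm v.ne_zero
    · exact absurd h u.ne_zero
    · exact congrArg some (Units.ext h)
  · intro x
    by_cases hx : x = 0
    · exact ⟨none, hx.symm⟩
    · exact ⟨some (Units.mk0 x hx), rfl⟩

variable [Algebra (ZMod 2) F]

/-- The words of the extended augmented code, in terms of their coefficients. -/
noncomputable def quadraticWord (σ : F ≃ₐ[ZMod 2] F) :
    F × F × F × ZMod 2 →ₗ[ZMod 2] (Option Fˣ → ZMod 2) where
  toFun p o := quadraticTrace σ p.1 p.2.1 p.2.2.1 (unitsOptionVal o) + p.2.2.2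
  map_add' p p' := by
    funext o
    simp only [quadraticTrace, Prod.fst_add, Prod.snd_add, Pi.add_apply, add_mul, map_add]
    ring
  map_smul' r p := by
    funext o
    simp only [quadraticTrace, Prod.smul_fst, Prod.smul_snd, Pi.smul_apply, RingHom.id_apply,
      smul_mul_assoc, ← smul_add, map_smul]

variable [Fintype F]

/-- Modulo 2^m - 1 the exponent reduces to some j < m, and then 2^j + 1 < 2^m - 1. The range of `i`
accommodates both `e` and `2 * e`. -/
lemma not_two_pow_sub_one_dvd {m i : ℕ} (hm : 3 ≤ m) (hi : i < 2 * m) :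
    ¬2 ^ m - 1 ∣ 2 ^ i + 1 := by
  have key : ∀ j < m, ¬2 ^ m - 1 ∣ 2 ^ j + 1 := by
    intro j hj h
    have h1 := Nat.le_of_dvd (by positivity) h
    obtain ⟨n, rfl⟩ : ∃ n, m = n + 3 := ⟨m - 3, by omega⟩
    have h2 : 2 ^ j ≤ 2 ^ (n + 2) := Nat.pow_le_pow_right (by norm_num) (by omega)
    have h3 := Nat.one_le_two_pow (n := n)
    simp only [pow_add] at h1 h2
    omega
  intro h
  by_cases hj : i < m
  · exact key i hj h
  · refine key (i - m) (by omega) ?_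
    have h1 : 2 ^ i + 1 = 2 ^ (i - m) * (2 ^ m - 1) + (2 ^ (i - m) + 1) := by
      have h3 : 2 ^ (i - m) * (2 ^ m - 1) + 2 ^ (i - m) = 2 ^ i := by
        rw [← Nat.mul_succ, Nat.succ_eq_add_one, Nat.sub_add_cancel Nat.one_le_two_pow, ← pow_add,
          Nat.sub_add_cancel (by omega)]
      omega
    rw [h1] at h
    exact (Nat.dvd_add_right (Dvd.intro_left _ rfl)).1 h

variable [DecidableEq F]

lemma sum_units_trace_eq_zero {m e : ℕ} (hm : 3 ≤ m) (hem : e < m)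
    (hF : Fintype.card F = 2 ^ m) (a b c : F) :
    ∑ x : Fˣ, Algebra.trace (ZMod 2) F
      (a * (x : F) ^ (2 ^ (2 * e) + 1) + b * (x : F) ^ (2 ^ e + 1) + c * (x : F)) = 0 := by
  have h : ∀ i, ¬2 ^ m - 1 ∣ i → ∑ x : Fˣ, (x : F) ^ i = 0 := fun i hi => by
    have := FiniteField.sum_pow_units F i
    rwa [hF, if_neg hi] at this
  have h1 : ∑ x : Fˣ, (x : F) = 0 := by
    simpa using h 1 fun h => by
      have h2 := Nat.le_of_dvd one_pos h
      have h3 : 2 ^ 3 ≤ 2 ^ m := Nat.pow_le_pow_right (by norm_num) hm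
      omega
  rw [← map_sum, Finset.sum_add_distrib, Finset.sum_add_distrib, ← Finset.mul_sum,
    ← Finset.mul_sum, ← Finset.mul_sum, h1, h _ (not_two_pow_sub_one_dvd hm (by omega)),
    h _ (not_two_pow_sub_one_dvd hm (by omega))]
  simp

/-- The trace part sums to zero over the units, and the number of units is odd, so the appended
coordinate is `h`, the value of the function at 0. -/
theorem extendedCode_eq_range {m e : ℕ} (hm : 3 ≤ m) (hem : e < m)
    (hF : Fintype.card F = 2 ^ m) (σ : F ≃ₐ[ZMod 2] F) (hσ : ∀ x, σ x = x ^ 2 ^ e) :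
    extendedCode (augmentedCode (threeZeroCode F e)) = LinearMap.range (quadraticWord σ) := by
  have hq : ∀ a b c x, quadraticTrace σ a b c x = Algebra.trace (ZMod 2) F
      (a * x ^ (2 ^ (2 * e) + 1) + b * x ^ (2 ^ e + 1) + c * x) := by
    intro a b c x
    rw [quadraticTrace, hσ, hσ, ← pow_mul, ← pow_add, ← two_mul, pow_succ, pow_succ]
  have hcard : ((Fintype.card Fˣ : ℕ) : ZMod 2) = 1 := by
    rw [Fintype.card_units, hF, Nat.cast_sub Nat.one_le_two_pow, Nat.cast_pow]
    simp only [Nat.cast_ofNat, Nat.cast_one]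
    rw [show (2 : ZMod 2) = 0 from rfl, zero_pow (by omega)]
    rfl
  have hw : ∀ (a b c : F) (h : ZMod 2), extendWord (fun x : Fˣ => Algebra.trace (ZMod 2) F
      (a * (x : F) ^ (2 ^ (2 * e) + 1) + b * (x : F) ^ (2 ^ e + 1) + c * (x : F)) + h) =
        quadraticWord σ (a, b, c, h) := by
    intro a b c h
    funext o
    rcases o with _ | x
    · simp only [extendWord, Finset.sum_add_distrib, sum_units_trace_eq_zero hm hem hF,
        Finset.sum_const, Finset.card_univ, nsmul_eq_mul, hcard, quadraticWord, LinearMap.coe_mk,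
        AddHom.coe_mk, unitsOptionVal, Option.elim_none, quadraticTrace_zero]
      revert h; decide
    · simp only [extendWord, quadraticWord, LinearMap.coe_mk, AddHom.coe_mk, unitsOptionVal,
        Option.elim_some, hq]
  ext w
  constructor
  · rintro ⟨c, hc, rfl⟩
    obtain ⟨_, ⟨a, b, c, rfl⟩, _, hz, rfl⟩ := Submodule.mem_sup.1 hc
    obtain ⟨h, rfl⟩ := Submodule.mem_span_singleton.1 hz
    refine ⟨(a, b, c, h), (hw a b c h).symm.trans ?_⟩
    congr 1
    funext x
    simp
  · rintro ⟨⟨a, b, c, h⟩, rfl⟩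
    refine ⟨_, Submodule.mem_sup.2 ⟨_, ⟨a, b, c, rfl⟩, fun _ => h,
      Submodule.mem_span_singleton.2 ⟨h, ?_⟩, rfl⟩, (hw a b c h).symm⟩
    funext x
    simp

/-- A vanishing word has vanishing polarization, so the kernel would be all of `F`, beyond the root
bound unless `a = b = 0`; nondegeneracy of the trace form then gives `c = 0`. -/
lemma quadraticWord_injective (σ : F ≃ₐ[ZMod 2] F)
    (hσ : (Finset.univ.filter fun y => σ y = y).card ^ 4 < Fintype.card F) :
    Function.Injective (quadraticWord σ) := by
  rw [← LinearMap.ker_eq_bot, LinearMap.ker_eq_bot']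
  rintro ⟨a, b, c, h⟩ hp
  have hp' : ∀ x, quadraticTrace σ a b c x + h = 0 := by
    intro x
    obtain ⟨o, rfl⟩ := unitsOptionVal_bijective.2 x
    exact congrFun hp o
  have hh : h = 0 := by simpa [quadraticTrace_zero] using hp' 0
  subst hh
  simp only [add_zero] at hp'
  have hab : a = 0 ∧ b = 0 := by
    by_contra hab
    refine absurd (natCard_ker_polarMap_le σ hab) (not_le.2 (hσ.trans_le ?_))
    have htop : LinearMap.ker (polarMap σ a b) = ⊤ := by
      refine Submodule.eq_top_iff'.2 fun y => ?_
      by_contra hy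
      obtain ⟨x, hx⟩ := exists_trace_mul_ne_zero hy
      have h1 := quadraticTrace_add σ a b c (σ.symm (σ.symm x)) y
      simp only [hp', AlgEquiv.apply_symm_apply, zero_add] at h1
      exact hx h1.symm
    rw [htop, Nat.card_congr (Submodule.topEquiv (R := ZMod 2) (M := F)).toEquiv,
      Nat.card_eq_fintype_card]
  obtain ⟨rfl, rfl⟩ := hab
  have hc : c = 0 := by
    by_contra hc
    obtain ⟨x, hx⟩ := exists_trace_mul_ne_zero hc
    refine hx ?_
    have := hp' x
    rw [quadraticTrace] at this
    rw [← this]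
    congr 1
    ring
  rw [hc]
  rfl

lemma mem_dualCode_range_quadraticWord (σ : F ≃ₐ[ZMod 2] F) (v : Option Fˣ → ZMod 2) :
    v ∈ dualCode (LinearMap.range (quadraticWord σ)) ↔
      ∑ o, v o = 0 ∧ ∑ o, v o • unitsOptionVal o = 0 ∧
        ∑ o, v o • (σ (unitsOptionVal o) * unitsOptionVal o) = 0 ∧
        ∑ o, v o • (σ (σ (unitsOptionVal o)) * unitsOptionVal o) = 0 := by
  have hdot : ∀ a b c h, v ⬝ᵥ quadraticWord σ (a, b, c, h) =
      Algebra.trace (ZMod 2) F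
        (a * ∑ o, v o • (σ (σ (unitsOptionVal o)) * unitsOptionVal o) +
          b * ∑ o, v o • (σ (unitsOptionVal o) * unitsOptionVal o) +
          c * ∑ o, v o • unitsOptionVal o) + h * ∑ o, v o := by
    intro a b c h
    simp only [Finset.mul_sum, ← Finset.sum_add_distrib, map_sum, dotProduct]
    refine Finset.sum_congr rfl fun o _ => ?_
    simp only [quadraticWord, LinearMap.coe_mk, AddHom.coe_mk, quadraticTrace, mul_smul_comm,
      ← smul_add, map_smul, smul_eq_mul]
    ring
  constructor
  · intro hv
    have hv' : ∀ a b c h, v ⬝ᵥ quadraticWord σ (a, b, c, h) = 0 := fun a b c h =>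
      hv _ ⟨(a, b, c, h), rfl⟩
    simp only [hdot] at hv'
    refine ⟨by simpa using hv' 0 0 0 1, ?_, ?_, ?_⟩
    · by_contra hz
      obtain ⟨x, hx⟩ := exists_trace_mul_ne_zero hz
      exact hx (by simpa using hv' 0 0 x 0)
    · by_contra hz
      obtain ⟨x, hx⟩ := exists_trace_mul_ne_zero hz
      exact hx (by simpa using hv' 0 x 0 0)
    · by_contra hz
      obtain ⟨x, hx⟩ := exists_trace_mul_ne_zero hz
      exact hx (by simpa using hv' x 0 0 0)
  · rintro ⟨h1, h2, h3, h4⟩ _ ⟨⟨a, b, c, h⟩, rfl⟩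
    rw [hdot, h1, h2, h3, h4]
    simp

end ThreeZeroCode

/-! ### The moment equations for the dual weights 6 and 8. -/

section WeightEight

variable {ι : Type*} [Fintype ι] [DecidableEq ι]

/-- The power moment method for a code all of whose words, except for the constant ones, have one
of the three distances `0`, `±√(2n)/2`, `±√(8n)/2` to half the length, and whose dual code has no
words of weight `2`, `4` or of odd weight. -/
theorem weight_count_of_three_values (D : Submodule (ZMod 2) (ι → ZMod 2))
    [DecidablePred (· ∈ D)] [DecidablePred (· ∈ dualCode D)] {n : ℕ} (hn0 : 0 < n)
    (hn : Fintype.card ι = n) (hD : Nat.card D = 2 * n ^ 3) (h1 : (1 : ι → ZMod 2) ∈ D)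
    (hP : ∀ c ∈ D, c ≠ 0 → c ≠ 1 → (∑ i, binarySign (c i)) ^ 2 = 0 ∨
      (∑ i, binarySign (c i)) ^ 2 = 2 * n ∨ (∑ i, binarySign (c i)) ^ 2 = 8 * n)
    (heven : ∀ v ∈ dualCode D, Even (hammingNorm v)) (h2 : ∀ v ∈ dualCode D, hammingNorm v ≠ 2)
    (h4 : ∀ v ∈ dualCode D, hammingNorm v ≠ 4) :
    ({v ∈ Finset.univ.filter (· ∈ dualCode D) | hammingNorm v = 6} : Finset _).card = 0 ∧
    40320 * (({v ∈ Finset.univ.filter (· ∈ dualCode D) | hammingNorm v = 8} : Finset _).card : ℤ) =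
      n * (n - 1) * (n ^ 3 - 12 * n ^ 2 + 156 * n - 272) := by
  rw [Nat.card_eq_fintype_card] at hD
  set s := Finset.univ.filter (· ∈ dualCode D) with hs
  let A : ℕ → ℤ := fun w => ({v ∈ s | hammingNorm v = w} : Finset _).card
  have hA : ∀ w, (∀ v ∈ dualCode D, hammingNorm v ≠ w) → A w = 0 := by
    intro w hw
    simp only [A, Nat.cast_eq_zero, Finset.card_eq_zero, Finset.filter_eq_empty_iff]
    exact fun v hv => hw v (Finset.mem_filter.1 hv).2
  have hodd : ∀ w, Odd w → A w = 0 := fun w hw => hA w fun v hv h =>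
    Nat.not_even_iff_odd.2 hw (h ▸ heven v hv)
  have hA0 : A 0 = 1 := by
    have : ({v ∈ s | hammingNorm v = 0} : Finset _) = {0} := by
      ext v
      simp only [hs, Finset.mem_filter, Finset.mem_univ, true_and, hammingNorm_eq_zero,
        Finset.mem_singleton]
      exact ⟨fun h => h.2, fun h => ⟨h ▸ zero_mem _, h⟩⟩
    simp only [A, this, Finset.card_singleton, Nat.cast_one]
  have hT : ∀ k ≤ 8, ∑ c : D, (∑ i, binarySign (c.1 i)) ^ k =
      2 * n ^ 3 * (oddTupleCount n k 0 + A 6 * oddTupleCount n k 6 +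
        A 8 * oddTupleCount n k 8) := by
    intro k hk
    have h := sum_oddTupleCount_hammingNorm s (k := k) (N := 9) (by omega)
    rw [sum_pow_sum_binarySign D k, h, hD, hn]
    have hz : ∀ w, (({v ∈ s | hammingNorm v = w} : Finset _).card : ℤ) = A w := fun _ => rfl
    simp only [Finset.sum_range_succ, Finset.sum_range_zero, hz, hA0, hodd 1 (by decide),
      hA 2 h2, hodd 3 (by decide), hA 4 h4, hodd 5 (by decide), hodd 7 (by decide)]
    push_cast
    ring
  have hz0 : (0 : D) ≠ ⟨1, h1⟩ := by
    intro h
    obtain ⟨i⟩ : Nonempty ι := Fintype.card_pos_iff.1 (hn ▸ hn0)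
    exact zero_ne_one (congrFun (congrArg Subtype.val h) i)
  -- Here 10 = 2 + 8 and 16 = 2 · 8: the combination vanishes at the three admissible values of P²,
  -- leaving the two constant words, where P² = n².
  have hsum : ∀ k, ∑ c : D, (∑ i, binarySign (c.1 i)) ^ (2 * (k + 3)) -
      10 * n * ∑ c : D, (∑ i, binarySign (c.1 i)) ^ (2 * (k + 2)) +
      16 * n ^ 2 * ∑ c : D, (∑ i, binarySign (c.1 i)) ^ (2 * (k + 1)) =
      2 * ((n : ℤ) ^ (2 * (k + 1)) * (n ^ 2 - 2 * n) * (n ^ 2 - 8 * n)) := by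
    intro k
    have hG : ∀ P N : ℤ, P ^ (2 * (k + 3)) - 10 * N * P ^ (2 * (k + 2)) +
        16 * N ^ 2 * P ^ (2 * (k + 1)) =
        (P ^ 2) ^ (k + 1) * (P ^ 2 - 2 * N) * (P ^ 2 - 8 * N) := fun P N => by ring
    rw [Finset.mul_sum, Finset.mul_sum, ← Finset.sum_sub_distrib, ← Finset.sum_add_distrib]
    simp only [hG]
    rw [← Finset.sum_subset (Finset.subset_univ {0, ⟨1, h1⟩}), Finset.sum_pair hz0]
    · simp [binarySign, hn]
      ring
    · intro c _ hc
      simp only [Finset.mem_insert, Finset.mem_singleton, not_or] at hc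
      rcases hP c.1 c.2 (fun h => hc.1 (Subtype.ext h)) (fun h => hc.2 (Subtype.ext h))
        with h | h | h <;> simp [h]
  have hn' : (2 * (n : ℤ) ^ 3) ≠ 0 := by positivity
  have e20 : oddTupleCount (n : ℤ) 2 0 = n := by simp [oddTupleCount]
  have e40 : oddTupleCount (n : ℤ) 4 0 = 3 * n ^ 2 - 2 * n := by simp [oddTupleCount]; ring
  have e60 : oddTupleCount (n : ℤ) 6 0 = 15 * n ^ 3 - 30 * n ^ 2 + 16 * n := by
    simp [oddTupleCount]; ring
  have e80 : oddTupleCount (n : ℤ) 8 0 = 105 * n ^ 4 - 420 * n ^ 3 + 588 * n ^ 2 - 272 * n := by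
    simp [oddTupleCount]; ring
  have e66 : oddTupleCount (n : ℤ) 6 6 = 720 := by norm_num [oddTupleCount]
  have e88 : oddTupleCount (n : ℤ) 8 8 = 40320 := by norm_num [oddTupleCount]
  have m2 := hT 2 (by norm_num)
  have m4 := hT 4 (by norm_num)
  have m6 := hT 6 (by norm_num)
  have m8 := hT 8 le_rfl
  rw [oddTupleCount_eq_zero (w := 6) _ (by norm_num),
    oddTupleCount_eq_zero (w := 8) _ (by norm_num), e20] at m2
  rw [oddTupleCount_eq_zero (w := 6) _ (by norm_num),
    oddTupleCount_eq_zero (w := 8) _ (by norm_num), e40] at m4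
  rw [oddTupleCount_eq_zero (w := 8) _ (by norm_num), e60, e66] at m6
  rw [e80, e88] at m8
  -- The first relation involves the moments 2, 4, 6 and hence only `A 6`; the second, with the
  -- moments 4, 6, 8, then determines `A 8`.
  have r0 := hsum 0
  have r1 := hsum 1
  norm_num only at r0 r1
  rw [m2, m4, m6] at r0
  rw [m4, m6, m8] at r1
  have a6 : A 6 = 0 := by
    have : 2 * (n : ℤ) ^ 3 * (720 * A 6) = 0 := by linear_combination r0
    simpa [hn0.ne'] using this
  rw [a6] at r1
  refine ⟨Int.natCast_eq_zero.1 a6, ?_⟩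
  change 40320 * A 8 = _
  refine mul_left_cancel₀ hn' ?_
  linear_combination r1

end WeightEight

/-! ### Dual words of weight 2 and 4. -/

section LowWeights

lemma sum_smul_eq_sum_support {F ι : Type*} [Field F] [Algebra (ZMod 2) F] [Fintype ι] (v : ι → ZMod 2) (g : ι → F) :
    ∑ o, v o • g o = ∑ o with v o ≠ 0, g o := by
  rw [Finset.sum_filter]
  refine Finset.sum_congr rfl fun o _ => ?_
  have : ∀ t : ZMod 2, t ≠ 0 → t = 1 := by decide
  split_ifs with h
  · rw [this _ h, one_smul]
  · rw [not_not.1 h, zero_smul]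

variable {F : Type*} [Field F] [Fintype F] [DecidableEq F] [Algebra (ZMod 2) F]

lemma hammingNorm_ne_two_of_mem_dual (σ : F ≃ₐ[ZMod 2] F) {v : Option Fˣ → ZMod 2}
    (hv : v ∈ dualCode (LinearMap.range (quadraticWord σ))) : hammingNorm v ≠ 2 := by
  have := charP_two_of_algebra_zmod F
  intro h
  obtain ⟨x, y, hxy, hs⟩ := Finset.card_eq_two.1 h
  have h2 := ((mem_dualCode_range_quadraticWord σ v).1 hv).2.1
  rw [sum_smul_eq_sum_support, hs, Finset.sum_pair hxy, CharTwo.add_eq_zero] at h2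
  exact hxy (unitsOptionVal_bijective.1 h2)

lemma even_hammingNorm_of_mem_dual (σ : F ≃ₐ[ZMod 2] F) {v : Option Fˣ → ZMod 2}
    (hv : v ∈ dualCode (LinearMap.range (quadraticWord σ))) : Even (hammingNorm v) := by
  have h := ((mem_dualCode_range_quadraticWord σ v).1 hv).1
  rw [← natCast_hammingNorm, ZMod.natCast_eq_zero_iff_even] at h
  exact h

lemma eq_zero_or_one_of_fixed {σ : F ≃ₐ[ZMod 2] F}
    (hσ : (Finset.univ.filter fun y => σ y = y).card ≤ 2) {u : F} (hu : σ u = u) :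
    u = 0 ∨ u = 1 := by
  by_contra! h
  have h3 : ({0, 1, u} : Finset F).card = 3 := by
    rw [Finset.card_eq_three]
    exact ⟨0, 1, u, zero_ne_one, h.1.symm, h.2.symm, rfl⟩
  have hle := Finset.card_le_card (s := {0, 1, u}) (t := Finset.univ.filter fun y => σ y = y)
    (by intro y; simp only [Finset.mem_insert, Finset.mem_singleton]; rintro (rfl | rfl | rfl) <;>
          simp [hu])
  omega

/-- The Gold function `x ↦ σ(x) x` is almost perfect nonlinear. -/
lemma eq_of_gold_sum_eq_zero {σ : F ≃ₐ[ZMod 2] F}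
    (hσ : (Finset.univ.filter fun y => σ y = y).card ≤ 2) {x y z w : F}
    (h1 : w + (x + (y + z)) = 0) (h2 : σ w * w + (σ x * x + (σ y * y + σ z * z)) = 0)
    (hxy : x ≠ y) : x = z ∨ y = z := by
  have := charP_two_of_algebra_zmod F
  have hw : w = x + y + z := by
    rw [CharTwo.add_eq_zero] at h1
    rw [h1, add_assoc]
  subst hw
  have hs : x + y ≠ 0 := fun h => hxy (CharTwo.add_eq_zero.1 h)
  have hs' : σ (x + y) ≠ 0 := (map_ne_zero σ).2 hs
  -- After eliminating `w`, the quadratic relation says σ(x+z)(x+y) = (x+z)σ(x+y); the fixed ratio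
  -- is 0 or 1.
  have hfix : σ ((x + z) / (x + y)) = (x + z) / (x + y) := by
    rw [map_div₀, div_eq_div_iff hs' hs, ← sub_eq_zero, CharTwo.sub_eq_add]
    simp only [map_add] at h2 ⊢
    linear_combination h2 - (σ y * y + σ z * z) * CharTwo.two_eq_zero (R := F)
  rcases eq_zero_or_one_of_fixed hσ hfix with h | h
  · left
    rw [div_eq_zero_iff, or_iff_left hs, CharTwo.add_eq_zero] at h
    exact h
  · right
    rw [div_eq_one_iff_eq hs] at h
    exact (add_left_cancel h).symm

lemma hammingNorm_ne_four_of_mem_dual {σ : F ≃ₐ[ZMod 2] F}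
    (hσ : (Finset.univ.filter fun y => σ y = y).card ≤ 2) {v : Option Fˣ → ZMod 2}
    (hv : v ∈ dualCode (LinearMap.range (quadraticWord σ))) : hammingNorm v ≠ 4 := by
  classical
  intro h
  obtain ⟨w, t, hwt, hs, ht⟩ := Finset.card_eq_succ.1 h
  obtain ⟨x, y, z, hxy, hxz, hyz, rfl⟩ := Finset.card_eq_three.1 ht
  obtain ⟨-, h1, h2, -⟩ := (mem_dualCode_range_quadraticWord σ v).1 hv
  have hx : x ∉ ({y, z} : Finset (Option Fˣ)) := by simp [hxy, hxz]
  rw [sum_smul_eq_sum_support, ← hs, Finset.sum_insert hwt, Finset.sum_insert hx,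
    Finset.sum_pair hyz] at h1 h2
  rcases eq_of_gold_sum_eq_zero hσ h1 h2 (unitsOptionVal_bijective.1.ne hxy) with h | h
  · exact hxz (unitsOptionVal_bijective.1 h)
  · exact hyz (unitsOptionVal_bijective.1 h)

lemma sum_ite_mem_four {M : Type*} [AddCommMonoid M] {z : F} (hz0 : z ≠ 0) (hz1 : z ≠ 1)
    (g : F → M) :
    (∑ o : Option Fˣ, if unitsOptionVal o ∈ ({0, 1, z, z + 1} : Finset F) then
      g (unitsOptionVal o) else 0) = g 0 + (g 1 + (g z + g (z + 1))) := by
  have := charP_two_of_algebra_zmod F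
  have hz2 : z + 1 ≠ 0 := fun h => hz1 (CharTwo.add_eq_zero.1 h)
  have h0 : (0 : F) ∉ ({1, z, z + 1} : Finset F) := by simp [hz0.symm, hz2.symm]
  have h1 : (1 : F) ∉ ({z, z + 1} : Finset F) := by simp [hz1.symm, hz0]
  have h3 : z ≠ z + 1 := by simp
  rw [unitsOptionVal_bijective.sum_comp
      (fun x => if x ∈ ({0, 1, z, z + 1} : Finset F) then g x else 0),
    Finset.sum_ite_mem, Finset.univ_inter, Finset.sum_insert h0, Finset.sum_insert h1,
    Finset.sum_pair h3]

/-- On fixed points of `σ` both σ(x)x and σ²(x)x equal x², which is additive, and the additive group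
{0, 1, z, z + 1} has sum zero. -/
lemma exists_hammingNorm_eq_four_of_fixed {σ : F ≃ₐ[ZMod 2] F} {z : F} (hz0 : z ≠ 0)
    (hz1 : z ≠ 1) (hz : σ z = z) :
    ∃ v ∈ dualCode (LinearMap.range (quadraticWord σ)), hammingNorm v = 4 := by
  have := charP_two_of_algebra_zmod F
  let v : Option Fˣ → ZMod 2 := fun o =>
    if unitsOptionVal o ∈ ({0, 1, z, z + 1} : Finset F) then 1 else 0
  have h2 : (2 : F) = 0 := CharTwo.two_eq_zero
  have hsmul : ∀ g : F → F, ∑ o, v o • g (unitsOptionVal o) = g 0 + (g 1 + (g z + g (z + 1))) := by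
    intro g
    rw [← sum_ite_mem_four hz0 hz1]
    refine Finset.sum_congr rfl fun o _ => ?_
    simp only [v]
    split_ifs <;> simp
  refine ⟨v, (mem_dualCode_range_quadraticWord σ v).2 ⟨?_, ?_, ?_, ?_⟩, ?_⟩
  · exact (sum_ite_mem_four hz0 hz1 fun _ => (1 : ZMod 2)).trans (by decide)
  · rw [hsmul fun x => x]
    linear_combination (1 + z) * h2
  · rw [hsmul fun x => σ x * x]
    simp only [map_add, map_zero, map_one, hz]
    linear_combination (1 + z + z ^ 2) * h2
  · rw [hsmul fun x => σ (σ x) * x]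
    simp only [map_add, map_zero, map_one, hz]
    linear_combination (1 + z + z ^ 2) * h2
  · rw [hammingNorm, Finset.card_filter]
    refine Eq.trans (Finset.sum_congr rfl fun o _ => ?_) (sum_ite_mem_four hz0 hz1 fun _ => (1 : ℕ))
    simp only [v]
    split_ifs <;> simp_all

end LowWeights

/-! ### Minimum distance, fixed elements and the arithmetic of m and e. -/

section QuadraticWordSums

lemma isLeast_hammingDist {K ι : Type*} [Field K] [DecidableEq K] [Fintype ι]
    {C : Submodule K (ι → K)} {d : ℕ} (hd : 0 < d) (hex : ∃ v ∈ C, hammingNorm v = d)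
    (hle : ∀ v ∈ C, v ≠ 0 → d ≤ hammingNorm v) :
    IsLeast {t : ℕ | ∃ x ∈ C, ∃ y ∈ C, x ≠ y ∧ hammingDist x y = t} d := by
  constructor
  · obtain ⟨v, hv, rfl⟩ := hex
    exact ⟨v, hv, 0, C.zero_mem, hammingNorm_pos_iff.1 hd, hammingDist_zero_right v⟩
  · rintro t ⟨x, hx, y, hy, hxy, rfl⟩
    rw [hammingDist_eq_hammingNorm]
    exact hle _ (C.add_mem (C.neg_mem hx) hy) fun h => hxy (neg_add_eq_zero.1 h)

/-- The unit group is cyclic and 2^d - 1 divides its order, so some unit has order 2^d - 1 ≥ 3. -/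
lemma exists_fixed_ne_zero_ne_one {F : Type*} [Field F] [Fintype F] [DecidableEq F] {m d : ℕ} (hd : 2 ≤ d) (hdm : d ∣ m)
    (hF : Fintype.card F = 2 ^ m) : ∃ z : F, z ≠ 0 ∧ z ≠ 1 ∧ z ^ 2 ^ d = z := by
  obtain ⟨g, hg⟩ := IsCyclic.exists_ofOrder_eq_natCard (α := Fˣ)
  rw [Nat.card_eq_fintype_card, Fintype.card_units, hF] at hg
  have h4 : 2 ^ 2 ≤ 2 ^ d := Nat.pow_le_pow_right (by norm_num) hd
  obtain ⟨k, hk⟩ := Nat.pow_sub_one_dvd_pow_sub_one 2 hdm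
  have hm0 : 0 < 2 ^ m - 1 := hg ▸ orderOf_pos g
  have hk0 : k ≠ 0 := by rintro rfl; omega
  have ho : orderOf (g ^ k) = 2 ^ d - 1 := by
    rw [orderOf_pow_of_dvd hk0 (by rw [hg, hk]; exact Dvd.intro_left _ rfl), hg, hk,
      Nat.mul_div_cancel _ (Nat.pos_of_ne_zero hk0)]
  refine ⟨(g ^ k : Fˣ), Units.ne_zero _, fun h => ?_, ?_⟩
  · rw [Units.val_eq_one.1 h, orderOf_one] at ho
    omega
  · rw [← Nat.sub_add_cancel (Nat.one_le_two_pow (n := d)), pow_succ, ← Units.val_pow_eq_pow_val,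
      ← ho, pow_orderOf_eq_one, Units.val_one, one_mul]

variable {F : Type*} [Field F] [Fintype F] [DecidableEq F] [Algebra (ZMod 2) F]

lemma sum_binarySign_quadraticWord (σ : F ≃ₐ[ZMod 2] F) (a b c : F) (h : ZMod 2) :
    ∑ o, binarySign (quadraticWord σ (a, b, c, h) o) =
      ∑ x, binarySign (quadraticTrace σ a b c x + h) :=
  unitsOptionVal_bijective.sum_comp fun x => binarySign (quadraticTrace σ a b c x + h)

lemma sq_sum_binarySign_quadraticWord_mem (σ : F ≃ₐ[ZMod 2] F) {m : ℕ}
    (hF : Fintype.card F = 2 ^ m) (hm : Odd m)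
    (hσ : (Finset.univ.filter fun y => σ y = y).card ≤ 2) {w : Option Fˣ → ZMod 2}
    (hw : w ∈ LinearMap.range (quadraticWord σ)) (h0 : w ≠ 0) (h1 : w ≠ 1) :
    (∑ o, binarySign (w o)) ^ 2 = 0 ∨ (∑ o, binarySign (w o)) ^ 2 = 2 * (2 ^ m : ℕ) ∨
      (∑ o, binarySign (w o)) ^ 2 = 8 * (2 ^ m : ℕ) := by
  obtain ⟨⟨a, b, c, h⟩, rfl⟩ := hw
  by_cases hab : a = 0 ∧ b = 0
  swap
  · push_cast
    exact sq_sum_binarySign_quadraticTrace_mem σ hF hm hσ hab c h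
      (sum_binarySign_quadraticWord σ a b c h)
  obtain ⟨rfl, rfl⟩ := hab
  -- Without quadratic part, a nonconstant word is affine with c ≠ 0, hence balanced.
  left
  rw [sq_eq_zero_iff, sum_binarySign_quadraticWord]
  have hq : ∀ x, quadraticTrace σ 0 0 c x = Algebra.trace (ZMod 2) F (x * c) := fun x => by
    simp [quadraticTrace, mul_comm]
  simp only [hq, binarySign_add]
  rw [← Finset.sum_mul]
  by_cases hc : c = 0
  · exfalso
    subst hc
    have hwh : quadraticWord σ (0, 0, 0, h) = fun _ => h := by
      funext o
      simp [quadraticWord, quadraticTrace]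
    rw [hwh] at h0 h1
    have : ∀ t : ZMod 2, t = 0 ∨ t = 1 := by decide
    rcases this h with rfl | rfl
    · exact h0 rfl
    · exact h1 rfl
  · rw [sum_binarySign_eq_zero _ (exists_trace_mul_ne_zero hc), zero_mul]
    intro x y
    rw [add_mul, map_add]

/-- The odd quotient m/d exceeds e/d ≥ 1, so it is at least 3; the value 3 would force e = m/3 or e
= 2m/3. -/
lemma five_mul_gcd_le {m e : ℕ} (he : 1 ≤ e) (hem : e < m) (he1 : 3 * e ≠ m)
    (he2 : 3 * e ≠ 2 * m) (hodd : Odd (m / Nat.gcd m e)) : 5 * Nat.gcd m e ≤ m := by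
  obtain ⟨k, hk⟩ := Nat.gcd_dvd_left m e
  obtain ⟨l, hl⟩ := Nat.gcd_dvd_right m e
  have hd : 0 < Nat.gcd m e := Nat.gcd_pos_of_pos_right _ he
  generalize Nat.gcd m e = d at *
  subst hl
  subst hk
  rw [Nat.mul_div_cancel_left _ hd] at hodd
  have hlk : l < k := Nat.lt_of_mul_lt_mul_left hem
  have hl0 : l ≠ 0 := by rintro rfl; simp at he
  rw [mul_comm]
  refine Nat.mul_le_mul_left d ?_
  by_contra! hk
  obtain ⟨t, rfl⟩ := hodd
  have ht : t = 1 := by omega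
  subst ht
  have : l = 1 ∨ l = 2 := by omega
  rcases this with rfl | rfl
  · exact he1 (by ring)
  · exact he2 (by ring)

end QuadraticWordSums

/-! ### The parameters of the dual code and the count of words of weight 8. -/

theorem mainTheorem2 (m e : ℕ) (hm : 5 ≤ m) (he : 1 ≤ e) (hem : e ≤ m - 1)
    (he1 : 3 * e ≠ m) (he2 : 3 * e ≠ 2 * m) (hodd : Odd (m / Nat.gcd m e))
    (F : Type*) [Field F] [Fintype F] [DecidableEq F] [Algebra (ZMod 2) F]
    (hF : Fintype.card F = 2 ^ m) :
    IsLinearCode (dualCode (extendedCode (augmentedCode (threeZeroCode F e))))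
        (2 ^ m) (2 ^ m - 3 * m - 1) (if Nat.gcd m e = 1 then 8 else 4) ∧
      (Nat.gcd m e = 1 →
        (weightCount (dualCode (extendedCode (augmentedCode (threeZeroCode F e)))) 8 : ℚ) =
          1 / 315 * (2 : ℚ) ^ ((m : ℤ) - 7) * (2 ^ m - 1) *
            (-272 + 39 * 2 ^ (2 + m) - 3 * 4 ^ (m + 1) + 8 ^ m)) := by
  classical
  let σ : F ≃ₐ[ZMod 2] F := FiniteField.frobeniusAlgEquivOfAlgebraic (ZMod 2) F ^ e
  have hσ : ∀ x, σ x = x ^ 2 ^ e := fun x => by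
    simp only [σ, AlgEquiv.coe_pow, FiniteField.coe_frobeniusAlgEquivOfAlgebraic_iterate,
      ZMod.card]
  have hem' : e < m := by omega
  rw [extendedCode_eq_range (by omega) hem' hF σ hσ]
  set D := LinearMap.range (quadraticWord σ) with hD
  have h5 := five_mul_gcd_le he hem' he1 he2 hodd
  have hd : 0 < Nat.gcd m e := Nat.gcd_pos_of_pos_right _ he
  have hfix : (Finset.univ.filter fun y => σ y = y).card ≤ 2 ^ Nat.gcd m e := by
    simp only [hσ]
    exact card_fixed_two_pow_le (by omega) hF
  have hinj : Function.Injective (quadraticWord σ) := by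
    refine quadraticWord_injective σ ((Nat.pow_le_pow_left hfix 4).trans_lt ?_)
    rw [hF, ← pow_mul]
    exact Nat.pow_lt_pow_right (by norm_num) (by omega)
  have hcard : Fintype.card (Option Fˣ) = 2 ^ m := by
    rw [Fintype.card_of_bijective unitsOptionVal_bijective, hF]
  have hFrank : Module.finrank (ZMod 2) F = m := by
    have h := Module.card_eq_pow_finrank (K := ZMod 2) (V := F)
    rw [hF, ZMod.card] at h
    exact (Nat.pow_right_injective le_rfl h).symm
  have hrank : Module.finrank (ZMod 2) D = 3 * m + 1 := by
    rw [hD, LinearMap.finrank_range_of_inj hinj]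
    simp only [Module.finrank_prod, hFrank, Module.finrank_self]
    ring
  have hcount : Nat.gcd m e = 1 →
      ({v ∈ Finset.univ.filter (· ∈ dualCode D) | hammingNorm v = 6} : Finset _).card = 0 ∧
      40320 * (({v ∈ Finset.univ.filter (· ∈ dualCode D) | hammingNorm v = 8} :
        Finset _).card : ℤ) = (2 ^ m : ℕ) * ((2 ^ m : ℕ) - 1) *
        ((2 ^ m : ℕ) ^ 3 - 12 * (2 ^ m : ℕ) ^ 2 + 156 * (2 ^ m : ℕ) - 272) := by
    intro hg
    rw [hg, pow_one] at hfix
    rw [hg, Nat.div_one] at hodd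
    refine weight_count_of_three_values D (by positivity) hcard ?_ ⟨(0, 0, 0, 1), ?_⟩
      (fun c hc => sq_sum_binarySign_quadraticWord_mem σ hF hodd hfix hc)
      (fun v => even_hammingNorm_of_mem_dual σ) (fun v => hammingNorm_ne_two_of_mem_dual σ)
      (fun v => hammingNorm_ne_four_of_mem_dual hfix)
    · rw [Module.natCard_eq_pow_finrank (K := ZMod 2), hrank,
        Nat.card_zmod]
      ring
    · funext o
      simp [quadraticWord, quadraticTrace]
  have hne : ∀ v ∈ dualCode D, v ≠ 0 → 4 ≤ hammingNorm v := by
    intro v hv h0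
    have h1 := hammingNorm_pos_iff.2 h0
    have h2 := hammingNorm_ne_two_of_mem_dual σ hv
    obtain ⟨t, ht⟩ := even_hammingNorm_of_mem_dual σ hv
    omega
  refine ⟨⟨hcard, ?_, ?_⟩, fun hg => ?_⟩
  · rw [finrank_dualCode, hrank, hcard, Nat.sub_sub]
  · split_ifs with hg
    · obtain ⟨h6, h8⟩ := hcount hg
      rw [hg, pow_one] at hfix
      refine isLeast_hammingDist (by norm_num) ?_ fun v hv h0 => ?_
      · by_contra! hno
        have hz : ({v ∈ Finset.univ.filter (· ∈ dualCode D) | hammingNorm v = 8} :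
            Finset _).card = 0 := by
          rw [Finset.card_eq_zero, Finset.filter_eq_empty_iff]
          exact fun v hv => hno v (Finset.mem_filter.1 hv).2
        rw [hz] at h8
        have hq : 2 ^ 5 ≤ 2 ^ m := Nat.pow_le_pow_right (by norm_num) hm
        generalize 2 ^ m = n at h8 hq
        obtain ⟨k, rfl⟩ := Nat.exists_eq_add_of_le hq
        push_cast at h8
        -- Since m ≥ 5, q = 32 + k; expanded in `k`, the cubic factor has positive coefficients
        -- only, so A₈ is nonzero.
        have hpos : (0 : ℤ) < (32 + k) * (32 + k - 1) *
            ((32 + k) ^ 3 - 12 * (32 + k) ^ 2 + 156 * (32 + k) - 272) := by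
          have : ((32 : ℤ) + k) * (32 + k - 1) *
              ((32 + k) ^ 3 - 12 * (32 + k) ^ 2 + 156 * (32 + k) - 272) =
              (32 + k) * (31 + k) * (k ^ 3 + 84 * k ^ 2 + 2460 * k + 25200) := by ring
          rw [this]
          positivity
        linarith
      · have h4 := hne v hv h0
        have h4' := hammingNorm_ne_four_of_mem_dual hfix hv
        have h6' : hammingNorm v ≠ 6 := fun h => by
          rw [Finset.card_eq_zero, Finset.filter_eq_empty_iff] at h6
          exact h6 (Finset.mem_filter.2 ⟨Finset.mem_univ _, hv⟩) h
        obtain ⟨t, ht⟩ := even_hammingNorm_of_mem_dual σ hv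
        omega
    · obtain ⟨z, hz0, hz1, hz⟩ := exists_fixed_ne_zero_ne_one (F := F) (d := Nat.gcd m e)
        (by omega) (Nat.gcd_dvd_left m e) hF
      refine isLeast_hammingDist (by norm_num)
        (exists_hammingNorm_eq_four_of_fixed (σ := σ) hz0 hz1 ?_) hne
      rw [hσ]
      -- The exponent `e` is a multiple of gcd(m, e), so a period gcd(m, e) under squaring is also a
      -- period `e`.
      obtain ⟨l, hl⟩ := Nat.gcd_dvd_right m e
      have hp : Function.IsPeriodicPt (fun x : F => x ^ 2) (Nat.gcd m e) z := by
        rw [Function.IsPeriodicPt, Function.IsFixedPt, pow_iterate]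
        exact hz
      have hp' := hp.mul_const l
      rwa [← hl, Function.IsPeriodicPt, Function.IsFixedPt, pow_iterate] at hp'
  · have h8 := (hcount hg).2
    have hw : weightCount (dualCode D) 8 =
        ({v ∈ Finset.univ.filter (· ∈ dualCode D) | hammingNorm v = 8} : Finset _).card := by
      rw [weightCount, ← Set.ncard_coe_finset]
      congr 1
      ext v
      simp
    rw [← hw] at h8
    have h8' : 40320 * (weightCount (dualCode D) 8 : ℚ) = 2 ^ m * (2 ^ m - 1) *
        ((2 ^ m) ^ 3 - 12 * (2 ^ m) ^ 2 + 156 * 2 ^ m - 272) := by exact_mod_cast h8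
    have e4 : (4 : ℚ) ^ (m + 1) = 4 * (2 ^ m) ^ 2 := by
      rw [pow_succ, show (4 : ℚ) = 2 ^ 2 by norm_num, ← pow_mul, ← pow_mul]; ring
    have e8 : (8 : ℚ) ^ m = (2 ^ m) ^ 3 := by
      rw [show (8 : ℚ) = 2 ^ 3 by norm_num, ← pow_mul, ← pow_mul, mul_comm]
    -- The constants agree because 40320 = 2^7 · 315.
    rw [zpow_sub₀ two_ne_zero, zpow_natCast, e4, e8, pow_add]
    norm_num
    linear_combination h8' / 40320
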